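/- Let $R$ be an infinite integral domain with identity, and let $P\in R[x,y]$. We say that $P$ satisfies Jacobi's identity if $$P(P(x,y),z)+P(P(y,z),x)+P(P(z,x),y)=0\qquad\text{for all }x,y,z\in R$$ (equivalently, since $R$ is an infinite domain, as an identity in $R[x,y,z]$). (1) If $\operatorname{char}(R)\neq 3$, then $P$ satisfies Jacobi's identity if and only if there exist $B,C\in R$ with $B^2+BC+C=0$ such that $P(x,y)=Bx+Cy$. (2) If $\operatorname{char}(R)=3$, then $P$ satisfies Jacobi's identity if and only if at least one of the following conditions holds: (a) there exist $A,B,D\in R$ with $AD=B^2-B$ such that $P(x,y)=Axy+B(x+y)+D$; (b) there exist $B,C,D\in R$ with $B^2+BC+C=0$ such that $P(x,y)=Bx+Cy+D$. In particular, in every characteristic, every $P$ that satisfies Jacobi's identity has degree at most one in each of the two variables. -/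

import Mathlib

open MvPolynomial

namespace JacobiPoly

/-- The value `P(a, b)` of a bivariate polynomial, the variables `X 0`, `X 1` being `x`, `y`. -/
noncomputable def ev {R : Type*} [CommRing R] (P : MvPolynomial (Fin 2) R) (a b : R) : R :=
  MvPolynomial.eval ![a, b] P

/-- Jacobi's identity `P(P(x,y),z) + P(P(y,z),x) + P(P(z,x),y) = 0`, as a functional equation
on `R`. -/
def SatisfiesJacobi {R : Type*} [CommRing R] (P : MvPolynomial (Fin 2) R) : Prop :=
  ∀ x y z : R, ev P (ev P x y) z + ev P (ev P y z) x + ev P (ev P z x) y = 0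

/-- The result `P(f, g)` of substituting trivariate polynomials in `P`. -/
noncomputable def subst {R : Type*} [CommRing R] (P : MvPolynomial (Fin 2) R)
    (f g : MvPolynomial (Fin 3) R) : MvPolynomial (Fin 3) R :=
  MvPolynomial.bind₁ ![f, g] P

/-- Over an infinite integral domain the functional equation is the same as the formal identity
in the polynomial ring in three variables. -/
theorem satisfiesJacobi_iff_formal {R : Type*} [CommRing R] [IsDomain R] [Infinite R]
    (P : MvPolynomial (Fin 2) R) :
    SatisfiesJacobi P ↔
      subst P (subst P (X 0) (X 1)) (X 2) + subst P (subst P (X 1) (X 2)) (X 0)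
        + subst P (subst P (X 2) (X 0)) (X 1) = 0 := by
  have key : ∀ (v : Fin 3 → R) (f g : MvPolynomial (Fin 3) R),
      MvPolynomial.eval v (subst P f g)
        = ev P (MvPolynomial.eval v f) (MvPolynomial.eval v g) := by
    intro v f g
    unfold subst ev
    rw [← MvPolynomial.coe_aeval_eq_eval, ← MvPolynomial.coe_aeval_eq_eval]
    simp only [RingHom.coe_coe, MvPolynomial.aeval_bind₁]
    congr 2
    funext i
    fin_cases i <;> rfl
  constructor
  · intro h
    apply MvPolynomial.funext
    intro v
    simpa [key] using h (v 0) (v 1) (v 2)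
  · intro h x y z
    have := congrArg (MvPolynomial.eval ![x, y, z]) h
    simpa [key] using this

end JacobiPoly

/-!
The proof compares degrees, uniformly in the characteristic. Write `P(x, y) = ∑ qᵢ(y) xⁱ`, of
degree `m` in `x` and `n` in `y`. For fixed `x` and `y`, Jacobi's identity is an identity between
the univariate polynomials `P(P(y, z), x)`, `P(P(z, x), y)`, `P(P(x, y), z)` in `z`.

Suppose `m ≥ 2`. The degrees in `z` give `m = n` (`natDegree_swap_eq_of_jacobiSlices`). Next, every
`qᵢ` with `i ≥ 1` is constant (`natDegree_coeff_eq_zero_of_jacobiSlices`). Indeed, let `t` be the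
largest index of a nonconstant `qᵢ` and fix `y` such that `f = P(·, y)` has degree `m`. Then
`P(z, x) = f(z) + l(z)` where `l` has degree at most `t` in `z` and the coefficient of `zᵗ` in `l`
is `qₜ(x) - qₜ(y)`. The expansion of `f(f + l)` in powers of `l` has a coefficient, at some `z ^ D`
with `D ≥ t m`, that is a nonconstant polynomial in `qₜ(x) - qₜ(y)` alone
(`exists_coeff_comp_add_eq_eval`); its dependence on `x` cannot be cancelled by the other two
summands. Hence `P(x, y) = f(x) + g(y)`, and then `f` is additive up to a constant. With
`k = f + g` and after removing constants, the identity becomes `f(k(x) - x) + k(x) = 0`, which is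
impossible for degree reasons when `deg f ≥ 2` (`not_forall_jacobi_separable`).

So `P(x, y) = a(y) x + b(y)`. The coefficients of `zᵏ yᵏ` for `k ≥ 2` show that `a` and `b` have
degree at most one (`natDegree_le_one_of_jacobi_linear`), and for `P = Axy + Bx + Cy + D` the
identity amounts to `3A² = 0`, `A(2B + C) = 0`, `B² + BC + C + AD = 0` and `3D(B + 1) = 0`. The
classification is read off from these equations.
-/

namespace JacobiPoly

open Polynomial.Bivariate
open scoped Polynomial

variable {R : Type*} [CommRing R]

/-! ### Bilinear polynomials -/

theorem satisfiesJacobi_bilinear {a b c d : R} (h1 : 3 * a = 0) (h2 : a * (2 * b + c) = 0)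
    (h3 : b ^ 2 + b * c + c + a * d = 0) (h4 : 3 * (d * (b + 1)) = 0) :
    SatisfiesJacobi (C a * X 0 * X 1 + C b * X 0 + C c * X 1 + C d : MvPolynomial (Fin 2) R) := by
  intro x y z
  simp only [ev, map_add, map_mul, eval_C, eval_X, Matrix.cons_val_zero, Matrix.cons_val_one]
  linear_combination a * x * y * z * h1 + (x * y + y * z + z * x) * h2 + (x + y + z) * h3 + h4

theorem degreeOf_bilinear_le_one [Nontrivial R] (a b c d : R) (i : Fin 2) :
    (C a * X 0 * X 1 + C b * X 0 + C c * X 1 + C d : MvPolynomial (Fin 2) R).degreeOf i ≤ 1 := by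
  refine (degreeOf_add_le _ _ _).trans (max_le ?_ (by simp))
  have hlin : ∀ (r : R) (j : Fin 2), (C r * X j : MvPolynomial (Fin 2) R).degreeOf i ≤ 1 := by
    intro r j
    refine (degreeOf_C_mul_le _ _ _).trans ?_
    rw [degreeOf_X]
    split_ifs <;> simp
  refine (degreeOf_add_le _ _ _).trans (max_le ?_ (hlin c 1))
  refine (degreeOf_add_le _ _ _).trans (max_le ?_ (hlin b 0))
  rw [mul_assoc]
  refine (degreeOf_C_mul_le _ _ _).trans ((degreeOf_mul_le _ _ _).trans ?_)
  rw [degreeOf_X, degreeOf_X]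
  fin_cases i <;> simp

/-! ### Bivariate polynomials and their slices -/

/-- The univariate polynomial `P(·, b)`, where `A` is `P` written as a polynomial in its first
variable whose coefficients are polynomials in its second variable; hence `slice (swap A) b` is
`P(b, ·)`. -/
noncomputable def slice (A : R[X][X]) (b : R) : R[X] :=
  A.map (Polynomial.evalRingHom b)

theorem coeff_slice (A : R[X][X]) (b : R) (i : ℕ) :
    (slice A b).coeff i = (A.coeff i).eval b := by
  simp [slice]

theorem natDegree_slice_le (A : R[X][X]) (b : R) : (slice A b).natDegree ≤ A.natDegree :=
  Polynomial.natDegree_map_le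

theorem natDegree_slice {A : R[X][X]} {b : R} (hb : A.leadingCoeff.eval b ≠ 0) :
    (slice A b).natDegree = A.natDegree :=
  Polynomial.natDegree_eq_of_le_of_coeff_ne_zero (natDegree_slice_le A b)
    (by rwa [coeff_slice])

theorem coeff_coeff_swap (A : R[X][X]) (i j : ℕ) :
    ((swap A).coeff j).coeff i = (A.coeff i).coeff j := by
  induction A using Polynomial.induction_on' with
  | add p q hp hq => simp [hp, hq]
  | monomial n a =>
    induction a using Polynomial.induction_on' with
    | add p q hp hq => simp [hp, hq]
    | monomial k r =>
      rw [swap_monomial_monomial]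
      by_cases h1 : n = i <;> by_cases h2 : k = j <;>
        simp [Polynomial.coeff_monomial, h1, h2]

theorem eval_slice_swap (A : R[X][X]) (x y : R) :
    (slice (swap A) x).eval y = (slice A y).eval x := by
  have h := aevalAeval_swap x y A
  simp only [Polynomial.coe_aevalAeval_eq_evalEval] at h
  simpa [slice, Polynomial.map_evalRingHom_eval] using h

/-- Evaluation of the bivariate polynomial `equivMvPolynomial.symm P`, whose outer variable is the
second one. -/
theorem eval_slice_equivMvPolynomial_symm (P : MvPolynomial (Fin 2) R) (x y : R) :
    (slice ((Polynomial.Bivariate.equivMvPolynomial R).symm P) x).eval y = ev P x y := by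
  rw [slice, Polynomial.map_evalRingHom_eval, ev]
  induction P using MvPolynomial.induction_on with
  | C a => simp
  | add p q hp hq => simp [hp, hq]
  | mul_X p i hp => fin_cases i <;> simp [hp, Polynomial.evalEval_C]

/-! ### Leading coefficients of perturbed compositions -/

/-- Among all perturbations `l` of `ψ` with `natDegree l ≤ t`, a suitable coefficient of
`F(ψ + l)`, at an index `D ≥ t * deg F`, is a nonconstant polynomial in the coefficient of `l` at
`t` alone. -/
theorem exists_coeff_comp_add_eq_eval (F ψ : R[X]) (t : ℕ) (hF : 0 < F.natDegree) :
    ∃ (D : ℕ) (c : R[X]), t * F.natDegree ≤ D ∧ 0 < c.natDegree ∧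
      (D = t * F.natDegree → c.natDegree = F.natDegree) ∧
      ∀ l : R[X], l.natDegree ≤ t → (F.comp (ψ + l)).coeff D = c.eval (l.coeff t) := by
  set m := F.natDegree with hm
  set G : R[X][X] := Polynomial.taylor ψ (F.map Polynomial.C) with hG
  have hdeg : (F.map Polynomial.C).natDegree = m :=
    Polynomial.natDegree_map_eq_of_injective Polynomial.C_injective F
  have hGdeg : G.natDegree = m := by rw [hG, Polynomial.natDegree_taylor, hdeg]
  have hGm : G.coeff m = Polynomial.C F.leadingCoeff := by
    have := Polynomial.coeff_taylor_natDegree (r := ψ) (f := F.map Polynomial.C)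
    rw [hdeg] at this
    rw [hG, this, Polynomial.leadingCoeff_map_of_injective Polynomial.C_injective]
  have hlead : F.leadingCoeff ≠ 0 := by
    rw [Ne, Polynomial.leadingCoeff_eq_zero]
    rintro rfl
    simp [hm] at hF
  -- The weight of `(G.coeff j) * l ^ j` when `l` has degree `t`; `D` is the largest one, `j ≥ 1`.
  obtain ⟨k, hk, hmax⟩ := (Finset.Icc 1 m).exists_max_image
    (fun j => (G.coeff j).natDegree + j * t) ⟨m, Finset.mem_Icc.2 ⟨hF, le_rfl⟩⟩
  rw [Finset.mem_Icc] at hk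
  set D := (G.coeff k).natDegree + k * t with hD
  have htm : t * m ≤ D := by
    have := hmax m (Finset.mem_Icc.2 ⟨hF, le_rfl⟩)
    simp only [hGm, Polynomial.natDegree_C, zero_add] at this
    rwa [mul_comm]
  set c : R[X] := ∑ j ∈ Finset.range (m + 1),
    Polynomial.C ((G.coeff j).coeff (D - j * t)) * Polynomial.X ^ j with hc
  have hcoeff : ∀ j ≤ m, c.coeff j = (G.coeff j).coeff (D - j * t) := by
    intro j hj
    simp [hc, Polynomial.coeff_X_pow, hj]
  have hcle : c.natDegree ≤ m := by
    refine Polynomial.natDegree_sum_le_of_forall_le _ _ fun j hj => ?_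
    exact (Polynomial.natDegree_C_mul_X_pow_le _ _).trans (Nat.lt_succ_iff.1 (Finset.mem_range.1 hj))
  have htop : D = t * m → c.natDegree = m := by
    intro h
    refine Polynomial.natDegree_eq_of_le_of_coeff_ne_zero hcle ?_
    rw [hcoeff m le_rfl, hGm, h, mul_comm t m, Nat.sub_self]
    simpa using hlead
  refine ⟨D, c, htm, ?_, htop, fun l hl => ?_⟩
  · by_cases h : D = t * m
    · rw [htop h]; exact hF
    · have hne : G.coeff k ≠ 0 := by
        intro h0
        have : D = k * t := by rw [hD, h0]; simp
        have : k * t ≤ m * t := Nat.mul_le_mul_right _ hk.2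
        rw [mul_comm m t] at this
        omega
      refine lt_of_lt_of_le hk.1 (Polynomial.le_natDegree_of_ne_zero ?_)
      rw [hcoeff k hk.2, hD, Nat.add_sub_cancel]
      exact Polynomial.leadingCoeff_ne_zero.2 hne
  · have hsum : F.comp (ψ + l) = ∑ j ∈ Finset.range (m + 1), G.coeff j * l ^ j := by
      rw [← Polynomial.eval_eq_sum_range' (Nat.lt_succ_of_le hGdeg.le), hG,
        Polynomial.taylor_eval, Polynomial.eval_map, add_comm]
      rfl
    rw [hsum, hc, Polynomial.finsetSum_coeff, Polynomial.eval_finsetSum]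
    refine Finset.sum_congr rfl fun j hj => ?_
    rw [Finset.mem_range] at hj
    rcases Nat.eq_zero_or_pos j with rfl | hj0
    · simp
    · have hw := hmax j (Finset.mem_Icc.2 ⟨hj0, Nat.lt_succ_iff.1 hj⟩)
      have hsplit : D = (D - j * t) + j * t := by omega
      conv_lhs => rw [hsplit]
      rw [Polynomial.coeff_mul_add_eq_of_natDegree_le (by omega)
        (Polynomial.natDegree_pow_le_of_le j hl), Polynomial.coeff_pow_of_natDegree_le hl]
      simp

/-! ### Degree comparison in the Jacobi identity -/

variable [IsDomain R] [Infinite R]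

theorem exists_eval_ne_zero {p : R[X]} (hp : p ≠ 0) : ∃ r, p.eval r ≠ 0 := by
  by_contra! h
  exact hp (Polynomial.funext fun r => by simpa using h r)

/-- The Jacobi identity, read for each pair of values `x`, `y` as an identity between univariate
polynomials in `z`. The summands are, in this order, `P(P(y, z), x)`, `P(P(z, x), y)` and
`P(P(x, y), z)`. -/
def JacobiSlices (A : R[X][X]) : Prop :=
  ∀ x y : R, (slice A x).comp (slice (swap A) y) + (slice A y).comp (slice A x)
    + slice (swap A) ((slice A y).eval x) = 0

theorem jacobiSlices_of_forall_eval {A : R[X][X]}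
    (h : ∀ x y z : R, (slice A z).eval ((slice A y).eval x)
      + (slice A x).eval ((slice A z).eval y) + (slice A y).eval ((slice A x).eval z) = 0) :
    JacobiSlices A := by
  intro x y
  refine Polynomial.funext fun z => ?_
  have := h x y z
  simp only [Polynomial.eval_add, Polynomial.eval_comp, eval_slice_swap, Polynomial.eval_zero]
  linear_combination this

/-- The degrees in `z` of the three summands are `m * n`, `m ^ 2` and at most `n`, where `m`, `n` are
the degrees of `P` in `x`, `y`; the largest of them has to occur twice. -/
theorem natDegree_swap_eq_of_jacobiSlices {A : R[X][X]} (hJ : JacobiSlices A)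
    (hm : 2 ≤ A.natDegree) : (swap A).natDegree = A.natDegree := by
  set B := swap A with hB
  have hA0 : A ≠ 0 := by rintro rfl; simp at hm
  have hB0 : B ≠ 0 := by simpa [hB] using hA0
  obtain ⟨y, hy⟩ := exists_eval_ne_zero (mul_ne_zero (Polynomial.leadingCoeff_ne_zero.2 hA0)
    (Polynomial.leadingCoeff_ne_zero.2 hB0))
  rw [Polynomial.eval_mul, mul_ne_zero_iff] at hy
  have h := hJ y y
  rw [← hB] at h
  set u := slice B ((slice A y).eval y)
  have hu : u.natDegree ≤ B.natDegree := natDegree_slice_le _ _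
  have d1 : ((slice A y).comp (slice B y)).natDegree = A.natDegree * B.natDegree := by
    rw [Polynomial.natDegree_comp, natDegree_slice hy.1, natDegree_slice hy.2]
  have d2 : ((slice A y).comp (slice A y)).natDegree = A.natDegree * A.natDegree := by
    rw [Polynomial.natDegree_comp, natDegree_slice hy.1]
  rcases lt_trichotomy B.natDegree A.natDegree with hlt | heq | hgt
  · have : (slice A y).comp (slice A y) = -((slice A y).comp (slice B y) + u) := by
      linear_combination h
    have h3 := congrArg Polynomial.natDegree this
    rw [Polynomial.natDegree_neg, d2] at h3
    have h4 := Polynomial.natDegree_add_le ((slice A y).comp (slice B y)) u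
    rw [← h3, d1] at h4
    rcases le_max_iff.1 h4 with h5 | h5 <;> nlinarith
  · exact heq
  · have : (slice A y).comp (slice B y) = -((slice A y).comp (slice A y) + u) := by
      linear_combination h
    have h3 := congrArg Polynomial.natDegree this
    rw [Polynomial.natDegree_neg, d1] at h3
    have h4 := Polynomial.natDegree_add_le ((slice A y).comp (slice A y)) u
    rw [← h3, d2] at h4
    rcases le_max_iff.1 h4 with h5 | h5 <;> nlinarith

/-- If `m = deg_x P` is at least two, then `P(x, y)` is a sum `f(x) + g(y)`: the coefficients of
`x, x ^ 2, …` do not depend on `y`. Otherwise, let `x ^ t` be the highest power with a nonconstant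
coefficient. In the coefficient of `z ^ D` provided by `exists_coeff_comp_add_eq_eval` for
`P(P(z, x), y)`, the three summands are polynomials in `x` whose degrees do not match. -/
theorem natDegree_coeff_eq_zero_of_jacobiSlices {A : R[X][X]} (hJ : JacobiSlices A)
    (hm : 2 ≤ A.natDegree) {i : ℕ} (hi : 1 ≤ i) : (A.coeff i).natDegree = 0 := by
  classical
  by_contra hcon
  set B := swap A with hB
  set m := A.natDegree with hmdef
  have hBm : B.natDegree = m := natDegree_swap_eq_of_jacobiSlices hJ hm
  have hA0 : A ≠ 0 := by rintro rfl; simp [hmdef] at hm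
  -- `t` is the largest index of a nonconstant coefficient.
  have hle : ∀ j, (A.coeff j).natDegree ≠ 0 → j ≤ m := fun j hj =>
    Polynomial.le_natDegree_of_ne_zero fun h => hj (by rw [h, Polynomial.natDegree_zero])
  obtain ⟨t, ht1, htne, htmax⟩ : ∃ t, 1 ≤ t ∧ (A.coeff t).natDegree ≠ 0 ∧
      ∀ j, (A.coeff j).natDegree ≠ 0 → j ≤ t := by
    have hspec := Nat.findGreatest_spec (P := fun j => (A.coeff j).natDegree ≠ 0)
      (hle i hcon) hcon
    exact ⟨_, hi.trans (Nat.le_findGreatest (hle i hcon) hcon), hspec,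
      fun j hj => Nat.le_findGreatest (hle j hj) hj⟩
  obtain ⟨y, hy⟩ := exists_eval_ne_zero (Polynomial.leadingCoeff_ne_zero.2 hA0)
  set f := slice A y with hf
  have hfm : f.natDegree = m := natDegree_slice hy
  obtain ⟨D, c, hD, hc0, hctop, hc⟩ := exists_coeff_comp_add_eq_eval f f t (by omega)
  rw [hfm] at hD hctop
  set τ : R[X] := A.coeff t - Polynomial.C ((A.coeff t).eval y) with hτ
  have hτdeg : τ.natDegree = (A.coeff t).natDegree := Polynomial.natDegree_sub_C
  have hldeg : ∀ x, (slice A x - f).natDegree ≤ t := by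
    intro x
    rw [Polynomial.natDegree_le_iff_coeff_eq_zero]
    intro j hj
    have : (A.coeff j).natDegree = 0 := by
      by_contra h
      exact absurd (htmax j h) (by omega)
    rw [Polynomial.coeff_sub, hf, coeff_slice, coeff_slice,
      Polynomial.eq_C_of_natDegree_eq_zero this]
    simp
  have hlcoeff : ∀ x, (slice A x - f).coeff t = τ.eval x := by
    intro x
    simp [hτ, hf, coeff_slice]
  set h := slice B y with hh
  have hhm : h.natDegree ≤ m := hBm ▸ natDegree_slice_le B y
  -- Only the coefficient of `l` at `t` can contribute to the coefficient of `l ∘ h` at `D`.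
  obtain ⟨b, hbD, hb⟩ : ∃ b : R, (D ≠ t * m → b = 0) ∧
      ∀ l : R[X], l.natDegree ≤ t → (l.comp h).coeff D = b * l.coeff t := by
    by_cases hDt : D = t * m
    · refine ⟨h.coeff m ^ t, fun h => absurd hDt h, fun l hl => ?_⟩
      rw [Polynomial.comp, Polynomial.eval₂_eq_sum_range' _ (Nat.lt_succ_of_le hl),
        Polynomial.finsetSum_coeff, Finset.sum_range_succ, Finset.sum_eq_zero, zero_add, hDt,
        Polynomial.coeff_C_mul, Polynomial.coeff_pow_of_natDegree_le hhm, mul_comm]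
      intro j hj
      rw [Polynomial.coeff_C_mul, Polynomial.coeff_eq_zero_of_natDegree_lt (p := h ^ j), mul_zero]
      refine (Polynomial.natDegree_pow_le_of_le j hhm).trans_lt ?_
      rw [hDt]
      exact Nat.mul_lt_mul_of_pos_right (Finset.mem_range.1 hj) (by omega)
    · refine ⟨0, fun _ => rfl, fun l hl => ?_⟩
      rw [zero_mul]
      refine Polynomial.coeff_eq_zero_of_natDegree_lt (Polynomial.natDegree_comp_le.trans_lt ?_)
      exact (Nat.mul_le_mul hl hhm).trans_lt (lt_of_le_of_ne hD (Ne.symm hDt))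
  set e : R[X] := c + (Polynomial.C b * Polynomial.X + Polynomial.C ((f.comp h).coeff D)) with he
  have hedeg : e.natDegree = c.natDegree := by
    by_cases hDt : D = t * m
    · refine Polynomial.natDegree_add_eq_left_of_natDegree_lt ?_
      rw [hctop hDt]
      exact Polynomial.natDegree_linear_le.trans_lt (by omega)
    · rw [he, hbD hDt]
      simp
  have key : e.comp τ = -(B.coeff D).comp f := by
    refine Polynomial.funext fun x => ?_
    have h1 := congrArg (fun p => Polynomial.coeff p D) (hJ x y)
    simp only [Polynomial.coeff_add, Polynomial.coeff_zero, ← hB, ← hf, ← hh, coeff_slice] at h1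
    have h2 := hc _ (hldeg x)
    have h3 := hb _ (hldeg x)
    rw [add_sub_cancel, hlcoeff] at h2
    rw [Polynomial.sub_comp, Polynomial.coeff_sub, hlcoeff] at h3
    simp only [he, Polynomial.eval_comp, Polynomial.eval_add, Polynomial.eval_mul,
      Polynomial.eval_C, Polynomial.eval_X, Polynomial.eval_neg]
    linear_combination h1 - h2 - h3
  -- The degrees in `x` leave only the possibility `D = m`, `t = 1`.
  have hdeg := congrArg Polynomial.natDegree key
  rw [Polynomial.natDegree_neg, Polynomial.natDegree_comp, Polynomial.natDegree_comp, hedeg,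
    hτdeg, hfm] at hdeg
  have hpos : 0 < c.natDegree * (A.coeff t).natDegree := Nat.mul_pos hc0 (Nat.pos_of_ne_zero htne)
  have hBD : (B.coeff D).natDegree ≠ 0 := by
    intro h0
    rw [h0, zero_mul] at hdeg
    omega
  have hDm : D ≤ m := by
    rw [← hBm]
    exact Polynomial.le_natDegree_of_ne_zero fun h => hBD (by rw [h, Polynomial.natDegree_zero])
  have ht : t = 1 := by nlinarith
  subst ht
  have hDeq : D = m := by omega
  subst hDeq
  rw [hctop (by omega), mul_comm, Nat.mul_left_inj (by omega)] at hdeg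
  -- The top coefficient of `B` is then linear, so `A.coeff 1` has a monomial of degree `m`.
  set s := (B.coeff A.natDegree).natDegree with hs
  have hne : (A.coeff s).coeff A.natDegree ≠ 0 := by
    rw [← coeff_coeff_swap, ← hB]
    exact Polynomial.leadingCoeff_ne_zero.2 fun h => hBD (by rw [hs, h, Polynomial.natDegree_zero])
  have hsm : A.natDegree ≤ (A.coeff s).natDegree := Polynomial.le_natDegree_of_ne_zero hne
  have hs1 : s = 1 := le_antisymm (htmax s (by omega)) (Nat.pos_of_ne_zero hBD)
  rw [hs1] at hsm hdeg
  omega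

/-! ### Separable polynomials -/

/-- A polynomial `f(x) + g(y)` with `deg f ≥ 2` and `g` nonconstant does not satisfy the Jacobi
identity: cancelling the parts that depend on one variable only shows that `f` is additive up to a
constant, and then the rest of the identity contradicts the degrees. -/
theorem not_forall_jacobi_separable {f g : R[X]} (hf : 2 ≤ f.natDegree) (hg : 0 < g.natDegree)
    (h : ∀ x y z : R, f.eval (f.eval x + g.eval y) + g.eval z
      + (f.eval (f.eval y + g.eval z) + g.eval x)
      + (f.eval (f.eval z + g.eval x) + g.eval y) = 0) : False := by
  -- A polynomial identity in values of a nonconstant polynomial holds everywhere.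
  have dense : ∀ p q : R[X], 0 < q.natDegree → (∀ x, p.eval (q.eval x) = 0) → ∀ u, p.eval u = 0 := by
    intro p q hq hp u
    have h0 : p.comp q = 0 := Polynomial.funext fun x => by simpa using hp x
    rcases Polynomial.comp_eq_zero_iff.1 h0 with h1 | ⟨-, h1⟩
    · simp [h1]
    · rw [h1, Polynomial.natDegree_C] at hq
      exact absurd hq (lt_irrefl 0)
  have step1 : ∀ x y, f.eval (f.eval x + g.eval y) - f.eval (f.eval 0 + g.eval y)
      - f.eval (f.eval x + g.eval 0) + f.eval (f.eval 0 + g.eval 0) = 0 := fun x y => by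
    linear_combination h x y 0 - h 0 y 0 - h x 0 0 + h 0 0 0
  have step2 : ∀ u y, f.eval (u + g.eval y) - f.eval (f.eval 0 + g.eval y)
      - f.eval (u + g.eval 0) + f.eval (f.eval 0 + g.eval 0) = 0 := by
    intro u y
    have := dense (f.comp (Polynomial.X + Polynomial.C (g.eval y))
      - Polynomial.C (f.eval (f.eval 0 + g.eval y))
      - f.comp (Polynomial.X + Polynomial.C (g.eval 0))
      + Polynomial.C (f.eval (f.eval 0 + g.eval 0))) f (by omega)
      (fun x => by simpa using step1 x y) u
    simpa using this
  have step3 : ∀ u w, f.eval (u + w) - f.eval (f.eval 0 + w)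
      - f.eval (u + g.eval 0) + f.eval (f.eval 0 + g.eval 0) = 0 := by
    intro u w
    have := dense (f.comp (Polynomial.C u + Polynomial.X)
      - f.comp (Polynomial.C (f.eval 0) + Polynomial.X)
      - Polynomial.C (f.eval (u + g.eval 0))
      + Polynomial.C (f.eval (f.eval 0 + g.eval 0))) g hg
      (fun y => by simpa using step2 u y) w
    simpa using this
  have hadd : ∀ u w, f.eval (u + w) = f.eval u + f.eval w - f.eval 0 := by
    intro u w
    have h1 := step3 u w
    have h2 := step3 u 0
    have h3 := step3 0 w
    have h4 := step3 0 0
    simp only [add_zero, zero_add] at h1 h2 h3 h4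
    linear_combination h1 - h2 - h3 + h4
  -- Up to constants, the identity becomes `f(k - x) + k = 0` with `k = f + g`.
  set k : R[X] := f + g with hk
  obtain ⟨a, ha⟩ : ∃ a : R, f.comp (k - Polynomial.X) + k = Polynomial.C a := by
    refine ⟨(f.comp (k - Polynomial.X) + k).eval 0, Polynomial.funext fun x => ?_⟩
    have e1 : ∀ u, f.eval (f.eval u + g.eval u - u)
        = f.eval (f.eval u) + f.eval (g.eval u) - f.eval u := by
      intro u
      have h1 := hadd (f.eval u + g.eval u - u) u
      rw [sub_add_cancel, hadd] at h1
      linear_combination -h1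
    have h1 := h x 0 0
    have h0 := h 0 0 0
    simp only [hadd] at h1 h0
    simp only [hk, Polynomial.eval_add, Polynomial.eval_comp, Polynomial.eval_sub,
      Polynomial.eval_X, Polynomial.eval_C, e1]
    linear_combination h1 - h0
  have hkeq : f.comp (k - Polynomial.X) = -(k - Polynomial.C a) := by linear_combination ha
  have hd := congrArg Polynomial.natDegree hkeq
  rw [Polynomial.natDegree_comp, Polynomial.natDegree_neg, Polynomial.natDegree_sub_C] at hd
  rcases Nat.lt_or_ge 1 k.natDegree with hk1 | hk1
  · have : (k - Polynomial.X).natDegree = k.natDegree :=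
      Polynomial.natDegree_sub_eq_left_of_natDegree_lt (by simpa using hk1)
    rw [this] at hd
    nlinarith
  · have h0 : (k - Polynomial.X).natDegree = 0 := by
      by_contra hne
      have : 2 * 1 ≤ f.natDegree * (k - Polynomial.X).natDegree :=
        Nat.mul_le_mul hf (Nat.pos_of_ne_zero hne)
      omega
    rw [h0, mul_zero] at hd
    have hX : (Polynomial.X : R[X]) = k - (k - Polynomial.X) := by ring
    have := congrArg Polynomial.natDegree hX
    rw [Polynomial.eq_C_of_natDegree_eq_zero h0, Polynomial.eq_C_of_natDegree_eq_zero hd.symm,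
      ← Polynomial.C_sub, Polynomial.natDegree_C, Polynomial.natDegree_X] at this
    exact one_ne_zero this

/-! ### Reduction to bilinear polynomials -/

theorem natDegree_le_one_of_jacobiSlices {A : R[X][X]} (hJ : JacobiSlices A) :
    A.natDegree ≤ 1 := by
  by_contra hcon
  have hm : 2 ≤ A.natDegree := by omega
  have hA0 : A ≠ 0 := by rintro rfl; simp at hm
  have hconst : ∀ i, 1 ≤ i → ∀ y, (A.coeff i).eval y = (A.coeff i).eval 0 := by
    intro i hi y
    rw [Polynomial.eq_C_of_natDegree_eq_zero (natDegree_coeff_eq_zero_of_jacobiSlices hJ hm hi)]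
    simp
  set f := slice A 0 with hf
  set g := A.coeff 0 - Polynomial.C ((A.coeff 0).eval 0) with hg
  have hA : ∀ y, slice A y = f + Polynomial.C (g.eval y) := by
    intro y
    ext i
    rcases Nat.eq_zero_or_pos i with rfl | hi
    · simp [hf, hg, coeff_slice]
    · simp [hf, coeff_slice, hconst i hi y, Polynomial.coeff_C, hi.ne']
  have hfdeg : f.natDegree = A.natDegree := by
    obtain ⟨y, hy⟩ := exists_eval_ne_zero (Polynomial.leadingCoeff_ne_zero.2 hA0)
    rw [← natDegree_slice hy, hA y, Polynomial.natDegree_add_C]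
  have hgdeg : 0 < g.natDegree := by
    rw [hg, Polynomial.natDegree_sub_C]
    by_contra h0
    have hcoeff : ∀ i, (A.coeff i).natDegree = 0 := by
      intro i
      rcases Nat.eq_zero_or_pos i with rfl | hi
      · omega
      · exact natDegree_coeff_eq_zero_of_jacobiSlices hJ hm hi
    have hB : (swap A).natDegree ≤ 0 := by
      refine Polynomial.natDegree_le_iff_coeff_eq_zero.2 fun j hj => ?_
      ext i
      rw [coeff_coeff_swap, Polynomial.coeff_eq_zero_of_natDegree_lt (by rw [hcoeff i]; exact hj)]
      simp
    rw [natDegree_swap_eq_of_jacobiSlices hJ hm] at hB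
    omega
  refine not_forall_jacobi_separable (hfdeg ▸ hm) hgdeg fun x y z => ?_
  have h := congrArg (Polynomial.eval z) (hJ x y)
  simp only [Polynomial.eval_add, Polynomial.eval_comp, eval_slice_swap, Polynomial.eval_zero, hA,
    Polynomial.eval_C] at h
  linear_combination h

/-- A solution of degree at most one in its first variable is of degree at most one in its second
variable too. -/
theorem natDegree_le_one_of_jacobi_linear {a b : R[X]}
    (h : ∀ x y z : R, a.eval z * (a.eval y * x + b.eval y) + b.eval z
      + (a.eval x * (a.eval z * y + b.eval z) + b.eval x)
      + (a.eval y * (a.eval x * z + b.eval x) + b.eval y) = 0) :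
    a.natDegree ≤ 1 ∧ b.natDegree ≤ 1 := by
  -- The coefficient of `z ^ k`, and then that of `y ^ k` in it.
  have hz : ∀ k, 2 ≤ k → ∀ x y, a.coeff k * (a.eval y * x + b.eval y)
      + b.coeff k + a.eval x * (a.coeff k * y + b.coeff k) = 0 := by
    intro k hk x y
    have hp : a * Polynomial.C (a.eval y * x + b.eval y) + b
        + Polynomial.C (a.eval x) * (a * Polynomial.C y + b)
        + Polynomial.C (a.eval y * a.eval x) * Polynomial.X
        + Polynomial.C (b.eval x + a.eval y * b.eval x + b.eval y) = 0 :=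
      Polynomial.funext fun z => by
        simp only [Polynomial.eval_add, Polynomial.eval_mul, Polynomial.eval_C, Polynomial.eval_X,
          Polynomial.eval_zero]
        linear_combination h x y z
    have := congrArg (fun p => Polynomial.coeff p k) hp
    simpa only [Polynomial.coeff_add, Polynomial.coeff_C_mul, Polynomial.coeff_mul_C,
      Polynomial.coeff_X, Polynomial.coeff_C, if_neg (show ¬ 1 = k by omega),
      if_neg (show ¬ k = 0 by omega), mul_zero, add_zero, Polynomial.coeff_zero] using this
  have hyz : ∀ k, 2 ≤ k → ∀ x, a.coeff k * (a.coeff k * x + b.coeff k) = 0 := by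
    intro k hk x
    have hp : Polynomial.C (a.coeff k) * (a * Polynomial.C x + b)
        + Polynomial.C (a.eval x * a.coeff k) * Polynomial.X
        + Polynomial.C (b.coeff k + a.eval x * b.coeff k) = 0 :=
      Polynomial.funext fun y => by
        simp only [Polynomial.eval_add, Polynomial.eval_mul, Polynomial.eval_C, Polynomial.eval_X,
          Polynomial.eval_zero]
        linear_combination hz k hk x y
    have := congrArg (fun p => Polynomial.coeff p k) hp
    simpa only [Polynomial.coeff_add, Polynomial.coeff_C_mul, Polynomial.coeff_mul_C,
      Polynomial.coeff_X, Polynomial.coeff_C, if_neg (show ¬ 1 = k by omega),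
      if_neg (show ¬ k = 0 by omega), mul_zero, add_zero, Polynomial.coeff_zero] using this
  have ha : ∀ k, 2 ≤ k → a.coeff k = 0 := fun k hk => by
    have h2 : a.coeff k ^ 2 = 0 := by linear_combination hyz k hk 1 - hyz k hk 0
    simpa using h2
  refine ⟨Polynomial.natDegree_le_iff_coeff_eq_zero.2 fun k hk => ha k hk,
    Polynomial.natDegree_le_iff_coeff_eq_zero.2 fun k hk => ?_⟩
  -- The coefficient `(a(x) + 1) * b_k` of `z ^ k` forces `a = -1`, which fails in degree one.
  by_contra hb
  have ha1 : ∀ x, a.eval x = -1 := fun x => by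
    have h1 := hz k hk x 0
    rw [ha k hk] at h1
    exact mul_right_cancel₀ hb (by linear_combination h1)
  have h1 := h 1 0 0
  have h0 := h 0 0 0
  simp only [ha1] at h1 h0
  exact one_ne_zero (α := R) (by linear_combination h1 - h0)

/-- The solutions are of the form `Axy + Bx + Cy + D`, and the identity amounts to four equations
between the coefficients. -/
theorem exists_bilinear_of_satisfiesJacobi {P : MvPolynomial (Fin 2) R} (h : SatisfiesJacobi P) :
    ∃ a b c d : R, P = C a * X 0 * X 1 + C b * X 0 + C c * X 1 + C d ∧
      3 * a = 0 ∧ a * (2 * b + c) = 0 ∧ b ^ 2 + b * c + c + a * d = 0 ∧ 3 * (d * (b + 1)) = 0 := by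
  set A := swap ((Polynomial.Bivariate.equivMvPolynomial R).symm P) with hA
  have hev : ∀ x y, (slice A y).eval x = ev P x y := fun x y => by
    rw [← eval_slice_swap, hA, swap_swap_apply, eval_slice_equivMvPolynomial_symm]
  have hdeg : A.natDegree ≤ 1 := natDegree_le_one_of_jacobiSlices
    (jacobiSlices_of_forall_eval fun x y z => by simpa only [hev] using h x y z)
  have hlin : ∀ x y, ev P x y = (A.coeff 1).eval y * x + (A.coeff 0).eval y := fun x y => by
    have h1 := Polynomial.eq_X_add_C_of_natDegree_le_one ((natDegree_slice_le A y).trans hdeg)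
    rw [← hev, h1]
    simp [coeff_slice]
  obtain ⟨ha, hb⟩ := natDegree_le_one_of_jacobi_linear (a := A.coeff 1) (b := A.coeff 0)
    fun x y z => by simpa only [hlin] using h x y z
  obtain ⟨b, a, ha'⟩ : ∃ b a, ∀ y, (A.coeff 1).eval y = a * y + b :=
    ⟨_, _, fun y => by rw [Polynomial.eq_X_add_C_of_natDegree_le_one ha]; simp; rfl⟩
  obtain ⟨d, c, hb'⟩ : ∃ d c, ∀ y, (A.coeff 0).eval y = c * y + d :=
    ⟨_, _, fun y => by rw [Polynomial.eq_X_add_C_of_natDegree_le_one hb]; simp; rfl⟩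
  have hP : ∀ x y, ev P x y = a * x * y + b * x + c * y + d := fun x y => by
    rw [hlin, ha', hb']; ring
  -- The identity is a combination of `xyz`, `xy + yz + zx`, `x + y + z` and `1`; inclusion-exclusion
  -- over the values `0`, `1` of the variables isolates the coefficients.
  have h000 := h 0 0 0
  have h100 := h 1 0 0
  have h110 := h 1 1 0
  have h111 := h 1 1 1
  simp only [hP] at h000 h100 h110 h111
  have h3 : 3 * a ^ 2 = 0 := by linear_combination h111 - 3 * h110 + 3 * h100 - h000
  refine ⟨a, b, c, d, ?_, ?_, ?_, ?_, ?_⟩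
  · refine MvPolynomial.funext fun v => ?_
    have hv : v = ![v 0, v 1] := by
      funext i; fin_cases i <;> rfl
    have := hP (v 0) (v 1)
    rw [ev, ← hv] at this
    simpa using this
  · rcases mul_eq_zero.1 h3 with h | h
    · rw [h, zero_mul]
    · rw [pow_eq_zero_iff two_ne_zero] at h
      rw [h, mul_zero]
  · linear_combination h110 - 2 * h100 + h000
  · linear_combination h100 - h000
  · linear_combination h000

end JacobiPoly

/-! ### The classification -/

theorem mainTheorem1 {R : Type*} [CommRing R] [IsDomain R] [Infinite R]
    (P : MvPolynomial (Fin 2) R) :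
    (ringChar R ≠ 3 →
      (JacobiPoly.SatisfiesJacobi P ↔
        ∃ b c : R, b ^ 2 + b * c + c = 0 ∧ P = C b * X 0 + C c * X 1)) ∧
    (ringChar R = 3 →
      (JacobiPoly.SatisfiesJacobi P ↔
        (∃ a b d : R, a * d = b ^ 2 - b ∧
          P = C a * X 0 * X 1 + C b * (X 0 + X 1) + C d) ∨
        (∃ b c d : R, b ^ 2 + b * c + c = 0 ∧
          P = C b * X 0 + C c * X 1 + C d))) ∧
    (JacobiPoly.SatisfiesJacobi P → ∀ i : Fin 2, P.degreeOf i ≤ 1) := by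
  refine ⟨fun hchar => ⟨fun h => ?_, ?_⟩, fun hchar => ⟨fun h => ?_, ?_⟩, fun h i => ?_⟩
  · have h3 : (3 : R) ≠ 0 := by
      intro h0
      have hdvd : ringChar R ∣ 3 := ringChar.dvd (by exact_mod_cast h0)
      rcases (Nat.dvd_prime Nat.prime_three).1 hdvd with h1 | h1
      · exact CharP.ringChar_ne_one h1
      · exact hchar h1
    obtain ⟨a, b, c, d, rfl, h1, -, hbc, hd⟩ := JacobiPoly.exists_bilinear_of_satisfiesJacobi h
    obtain rfl : a = 0 := (mul_eq_zero.1 h1).resolve_left h3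
    rw [zero_mul, add_zero] at hbc
    -- `b = -1` is impossible, as it turns `b ^ 2 + b * c + c` into `1`.
    have hb : b + 1 ≠ 0 := fun hb =>
      one_ne_zero (α := R) (by linear_combination hbc - (b - 1 + c) * hb)
    obtain rfl : d = 0 := (mul_eq_zero.1 ((mul_eq_zero.1 hd).resolve_left h3)).resolve_right hb
    exact ⟨b, c, hbc, by simp⟩
  · rintro ⟨b, c, hbc, rfl⟩
    have := JacobiPoly.satisfiesJacobi_bilinear (a := 0) (b := b) (c := c) (d := 0) (by simp)
      (by simp) (by simpa using hbc) (by simp)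
    simpa using this
  · have h3 : (3 : R) = 0 := by
      have := ringChar.Nat.cast_ringChar (R := R)
      rw [hchar] at this
      exact_mod_cast this
    obtain ⟨a, b, c, d, rfl, -, h2, hbc, -⟩ := JacobiPoly.exists_bilinear_of_satisfiesJacobi h
    rcases eq_or_ne a 0 with rfl | ha
    · exact Or.inr ⟨b, c, d, by simpa using hbc, by simp⟩
    · have hc := (mul_eq_zero.1 h2).resolve_left ha
      obtain rfl : c = b := by linear_combination hc - b * h3
      exact Or.inl ⟨a, c, d, by linear_combination hbc - c ^ 2 * h3, by ring⟩
  · have h3 : (3 : R) = 0 := by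
      have := ringChar.Nat.cast_ringChar (R := R)
      rw [hchar] at this
      exact_mod_cast this
    rintro (⟨a, b, d, hb, rfl⟩ | ⟨b, c, d, hbc, rfl⟩)
    · have := JacobiPoly.satisfiesJacobi_bilinear (a := a) (b := b) (c := b) (d := d) (by simp [h3])
        (by linear_combination a * b * h3) (by linear_combination hb + b ^ 2 * h3) (by simp [h3])
      rwa [add_assoc (C a * X 0 * X 1), ← mul_add] at this
    · have := JacobiPoly.satisfiesJacobi_bilinear (a := 0) (b := b) (c := c) (d := d) (by simp)
        (by simp) (by simpa using hbc) (by simp [h3])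
      simpa using this
  · obtain ⟨a, b, c, d, rfl, -⟩ := JacobiPoly.exists_bilinear_of_satisfiesJacobi h
    exact JacobiPoly.degreeOf_bilinear_le_one a b c d i
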